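/- Let $$\widetilde U_3=\langle \mu_{12},\mu_{13},\mu_{23}\mid [\mu_{13},\mu_{23}]=1,\ \mu_{13}\mu_{23}\mu_{12}=\mu_{12}\mu_{23}\mu_{13}^{-1}\rangle$$ and $$\widetilde L_3=\langle \mu_{21},\mu_{31},\mu_{32}\mid [\mu_{21},\mu_{31}]=1,\ \mu_{31}\mu_{21}\mu_{32}=\mu_{32}\mu_{21}\mu_{31}^{-1}\rangle ,$$ where $[g,h]=g^{-1}h^{-1}gh$. Then both groups $\widetilde U_3$ and $\widetilde L_3$ are residually nilpotent; that is, for $G=\widetilde U_3$ and for $G=\widetilde L_3$, $$\bigcap_{n\ge 1}\gamma_n(G)=1,$$ where $\gamma_1(G)=G$ and $\gamma_{n+1}(G)=[\gamma_n(G),G]$ is the lower central series of $G$. -/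

import Mathlib

/-- A group `G` is residually nilpotent if the intersection of all the terms of its lower central
series is trivial. (The index is shifted by one: term `n` below is `γ_{n+1}(G)`, so that term `0`
is `G = γ_1(G)`.) -/
def ResiduallyNilpotent (G : Type*) [Group G] : Prop :=
  ⨅ n : ℕ, (⊤ : Subgroup G).lowerCentralSeries n = ⊥

/-- The generators `μ_{ij}`, `1 ≤ i < j ≤ 3`. -/
inductive UpperGen : Type
  | μ12 | μ13 | μ23

/-- The generators `μ_{ij}`, `1 ≤ j < i ≤ 3`. -/
inductive LowerGen : Type
  | μ21 | μ31 | μ32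

/-- The commutator `[g, h] = g⁻¹ h⁻¹ g h`. -/
def groupComm {G : Type*} [Group G] (g h : G) : G := g⁻¹ * h⁻¹ * g * h

/-- A relation `u = v`, written as the relator `u v⁻¹`. -/
def relator {G : Type*} [Group G] (u v : G) : G := u * v⁻¹

open FreeGroup in
/-- The relators of `Ũ₃`: the relations `μ_{ik} μ_{jk} = μ_{jk} μ_{ik}` and
`μ_{ik} μ_{jk} μ_{ij} = μ_{ij} μ_{jk} μ_{ik}⁻¹` with `(i, j, k) = (1, 2, 3)`. -/
def upperRels : Set (FreeGroup UpperGen) :=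
  {groupComm (of .μ13) (of .μ23),
   relator (of .μ13 * of .μ23 * of .μ12) (of .μ12 * of .μ23 * (of .μ13)⁻¹)}

open FreeGroup in
/-- The relators of `L̃₃`: the relations `μ_{ik} μ_{jk} = μ_{jk} μ_{ik}` and
`μ_{ik} μ_{jk} μ_{ij} = μ_{ij} μ_{jk} μ_{ik}⁻¹` with `(i, j, k) = (3, 2, 1)`. -/
def lowerRels : Set (FreeGroup LowerGen) :=
  {groupComm (of .μ21) (of .μ31),
   relator (of .μ31 * of .μ21 * of .μ32) (of .μ32 * of .μ21 * (of .μ31)⁻¹)}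

/-- `Ũ₃ = ⟨μ12, μ13, μ23 | [μ13, μ23] = 1, μ13 μ23 μ12 = μ12 μ23 μ13⁻¹⟩`. -/
abbrev UTilde3 : Type := PresentedGroup upperRels

/-- `L̃₃ = ⟨μ21, μ31, μ32 | [μ21, μ31] = 1, μ31 μ21 μ32 = μ32 μ21 μ31⁻¹⟩`. -/
abbrev LTilde3 : Type := PresentedGroup lowerRels

/-! Put a = μ13, b = μ23, t = μ12 (respectively μ31, μ21, μ32) and x = ab. The relations become
x⁻¹ax = a and x⁻¹tx = ta², so every element is w(a, t)xᵐ with w in a free group of rank two. If it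
lies in all terms of the lower central series, the map to ℤ killing a and t gives m = 0.

If w ≠ 1, then ρ(w) ≠ 1 for some ρ into a finite 2-group Q
(`FreeGroup.exists_isPGroup_two_map_ne_one`). Pairs (u, v) in Q × Q are the homomorphisms from the
free group to Q, and x permutes them by (u, v) ↦ (u, vu²), with 2-power order. Sending a, t to the
two projections Q × Q → Q thus maps the group to a finite 2-group, which is nilpotent
(`isPGroup_shearProduct`); the coordinate at ρ detects w. -/

/-! ### Sanov's subgroup and finite 2-quotients of the free group -/

open Matrix MatrixGroups in
/-- Sanov's generators of a free subgroup of `SL(2, ℤ)`. -/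
def sanovGen : Bool → SL(2, ℤ)
  | true => ⟨!![1, 2; 0, 1], by simp [Matrix.det_fin_two]⟩
  | false => ⟨!![1, 0; 2, 1], by simp [Matrix.det_fin_two]⟩

open Matrix MatrixGroups in
/-- The homomorphism from the free group of rank two onto Sanov's subgroup of `SL(2, ℤ)`. -/
def sanov : FreeGroup Bool →* SL(2, ℤ) := FreeGroup.lift sanovGen

open Matrix MatrixGroups in
/-- The attracting set of `sanovGen i`. -/
def sanovAttracting : Bool → Set SL(2, ℤ)
  | true => {M | M 1 0 * M 1 0 < M 0 0 * M 1 0}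
  | false => {M | M 0 0 * M 0 0 ≤ M 0 0 * M 1 0 ∧ M 0 0 ≠ 0}

open Matrix MatrixGroups in
/-- The attracting set of `(sanovGen i)⁻¹`. -/
def sanovRepelling : Bool → Set SL(2, ℤ)
  | true => {M | M 0 0 * M 1 0 ≤ -(M 1 0 * M 1 0)}
  | false => {M | M 0 0 * M 1 0 < -(M 0 0 * M 0 0) ∨ M 0 0 = 0}

open Matrix MatrixGroups in
theorem fst_ne_zero_or_snd_ne_zero (M : SL(2, ℤ)) : M 0 0 ≠ 0 ∨ M 1 0 ≠ 0 := by
  have h := M.det_coe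
  rw [Matrix.det_fin_two] at h
  by_contra! h'
  simp [h'.1, h'.2] at h

open Matrix MatrixGroups in
theorem sanovGen_true_mul (M : SL(2, ℤ)) :
    (sanovGen true * M) 0 0 = M 0 0 + 2 * M 1 0 ∧ (sanovGen true * M) 1 0 = M 1 0 := by
  change ((!![1, 2; 0, 1] : Matrix (Fin 2) (Fin 2) ℤ) * (M : Matrix (Fin 2) (Fin 2) ℤ)) 0 0 = _ ∧
    ((!![1, 2; 0, 1] : Matrix (Fin 2) (Fin 2) ℤ) * (M : Matrix (Fin 2) (Fin 2) ℤ)) 1 0 = _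
  simp [Matrix.mul_apply, Fin.sum_univ_two]

open Matrix MatrixGroups in
theorem sanovGen_false_mul (M : SL(2, ℤ)) :
    (sanovGen false * M) 0 0 = M 0 0 ∧ (sanovGen false * M) 1 0 = 2 * M 0 0 + M 1 0 := by
  change ((!![1, 0; 2, 1] : Matrix (Fin 2) (Fin 2) ℤ) * (M : Matrix (Fin 2) (Fin 2) ℤ)) 0 0 = _ ∧
    ((!![1, 0; 2, 1] : Matrix (Fin 2) (Fin 2) ℤ) * (M : Matrix (Fin 2) (Fin 2) ℤ)) 1 0 = _
  simp [Matrix.mul_apply, Fin.sum_univ_two]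

open Matrix MatrixGroups Pointwise in
-- Ping-pong on the slope s = p/q of the first column (p, q): the four sets are s > 1, 0 < s ≤ 1, -1
-- < s ≤ 0, and s ≤ -1 or s = ∞. The generators act by s ↦ s + 2 and 1/s ↦ 1/s + 2.
theorem sanov_injective : Function.Injective sanov := by
  refine FreeGroup.injective_lift_of_ping_pong sanovGen sanovAttracting sanovRepelling
    ?_ ?_ ?_ ?_ ?_ ?_
  · rintro (_ | _)
    · refine ⟨⟨!![1, 0; 1, 1], by simp [Matrix.det_fin_two]⟩, ?_⟩
      change (1 : ℤ) * 1 ≤ 1 * 1 ∧ (1 : ℤ) ≠ 0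
      norm_num
    · refine ⟨⟨!![2, 1; 1, 1], by simp [Matrix.det_fin_two]⟩, ?_⟩
      change (1 : ℤ) * 1 < 2 * 1
      norm_num
  · have h : Disjoint (sanovAttracting false) (sanovAttracting true) := by
      rw [Set.disjoint_left]
      intro M
      simp only [sanovAttracting, Set.mem_ofPred_eq]
      rintro ⟨h1, -⟩ h2
      nlinarith [sq_nonneg (M 0 0 - M 1 0)]
    rintro (_ | _) (_ | _) hij
    exacts [absurd rfl hij, h, h.symm, absurd rfl hij]
  · have h : Disjoint (sanovRepelling false) (sanovRepelling true) := by
      rw [Set.disjoint_left]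
      intro M
      simp only [sanovRepelling, Set.mem_ofPred_eq]
      rintro (h1 | h1) h2
      · nlinarith [sq_nonneg (M 0 0 + M 1 0)]
      · rcases fst_ne_zero_or_snd_ne_zero M with h3 | h3
        · exact h3 h1
        · rw [h1] at h2
          nlinarith [mul_self_pos.2 h3]
    rintro (_ | _) (_ | _) hij
    exacts [absurd rfl hij, h, h.symm, absurd rfl hij]
  · rintro (_ | _) (_ | _) <;> rw [Set.disjoint_left] <;> intro M <;>
      simp only [sanovAttracting, sanovRepelling, Set.mem_ofPred_eq]
    · rintro ⟨h1, h2⟩ (h3 | h3)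
      · nlinarith [mul_self_nonneg (M 0 0)]
      · exact h2 h3
    · rintro ⟨h1, h2⟩ h3
      nlinarith [mul_self_pos.2 h2, mul_self_nonneg (M 1 0)]
    · rintro h1 (h3 | h3)
      · nlinarith [mul_self_nonneg (M 0 0), mul_self_nonneg (M 1 0)]
      · rw [h3] at h1
        nlinarith [mul_self_nonneg (M 1 0)]
    · intro h1 h3
      nlinarith [mul_self_nonneg (M 1 0)]
  · rintro (_ | _) _ ⟨M, hM, rfl⟩ <;>
      simp only [sanovAttracting, sanovRepelling, Set.mem_compl_iff, Set.mem_ofPred_eq, not_or,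
        smul_eq_mul, sanovGen_true_mul, sanovGen_false_mul] at hM ⊢
    · exact ⟨by linarith, hM.2⟩
    · linarith
  · rintro (_ | _) _ ⟨M, hM, rfl⟩
    · obtain ⟨N, rfl⟩ : ∃ N, M = sanovGen false * N := ⟨_, (mul_inv_cancel_left _ M).symm⟩
      simp only [sanovAttracting, sanovRepelling, Set.mem_compl_iff, Set.mem_ofPred_eq,
        smul_eq_mul, Pi.inv_apply, inv_mul_cancel_left, sanovGen_false_mul] at hM ⊢
      by_cases h : N 0 0 = 0
      · exact Or.inr h
      · left
        by_contra! h'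
        exact hM ⟨by linarith, h⟩
    · obtain ⟨N, rfl⟩ : ∃ N, M = sanovGen true * N := ⟨_, (mul_inv_cancel_left _ M).symm⟩
      simp only [sanovAttracting, sanovRepelling, Set.mem_compl_iff, Set.mem_ofPred_eq,
        smul_eq_mul, Pi.inv_apply, inv_mul_cancel_left, sanovGen_true_mul] at hM ⊢
      linarith

open Matrix MatrixGroups in
theorem sanov_map_two (w : FreeGroup Bool) :
    SpecialLinearGroup.map (Int.castRingHom (ZMod 2)) (sanov w) = 1 := by
  have h : (SpecialLinearGroup.map (Int.castRingHom (ZMod 2))).comp sanov = 1 := by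
    ext i j k
    rcases i with _ | _ <;> simp only [sanov, MonoidHom.comp_apply, FreeGroup.lift_apply_of] <;>
      fin_cases j <;> fin_cases k <;> decide
  exact DFunLike.congr_fun h w

theorem Matrix.exists_pow_two_pow_eq {n : Type*} [Fintype n] [DecidableEq n]
    (M N : Matrix n n ℤ) (h : M = 1 + (2 : ℤ) • N) (k : ℕ) :
    ∃ N' : Matrix n n ℤ, M ^ 2 ^ k = 1 + (2 ^ (k + 1) : ℤ) • N' := by
  induction k with
  | zero => exact ⟨N, by simpa using h⟩
  | succ k ih =>
    obtain ⟨N', hN'⟩ := ih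
    -- (1 + 2ᵏ⁺¹N')² = 1 + 2ᵏ⁺²(N' + 2ᵏN'²).
    refine ⟨N' + (2 ^ k : ℤ) • (N' * N'), ?_⟩
    rw [pow_succ, pow_mul, hN', sq]
    simp only [mul_add, add_mul, mul_one, one_mul, smul_mul_assoc, mul_smul_comm, smul_add,
      smul_smul]
    rw [add_assoc, ← add_assoc (_ • N'), ← add_smul]
    congr 3 <;> ring

open Matrix MatrixGroups in
theorem exists_sanov_eq (w : FreeGroup Bool) :
    ∃ N : Matrix (Fin 2) (Fin 2) ℤ, (sanov w : Matrix (Fin 2) (Fin 2) ℤ) = 1 + (2 : ℤ) • N := by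
  have key (i j : Fin 2) : (2 : ℤ) ∣ sanov w i j - (1 : Matrix (Fin 2) (Fin 2) ℤ) i j := by
    have h := congrArg (fun M : SL(2, ZMod 2) => M i j) (sanov_map_two w)
    have h2 := (ZMod.intCast_zmod_eq_zero_iff_dvd
      (sanov w i j - (1 : Matrix (Fin 2) (Fin 2) ℤ) i j) 2).1
    refine h2 ?_
    push_cast
    rw [sub_eq_zero]
    simpa [Matrix.one_apply] using h
  choose N hN using key
  refine ⟨Matrix.of N, ?_⟩
  ext i j
  have := hN i j
  simp only [Matrix.add_apply, Matrix.smul_apply, Matrix.of_apply, smul_eq_mul]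
  linarith

open Matrix MatrixGroups in
/-- Sanov's homomorphism modulo `2 ^ k`. -/
def sanovMod (k : ℕ) : FreeGroup Bool →* SL(2, ZMod (2 ^ k)) :=
  (SpecialLinearGroup.map (Int.castRingHom (ZMod (2 ^ k)))).comp sanov

open Matrix MatrixGroups in
theorem sanovMod_apply (k : ℕ) (w : FreeGroup Bool) (i j : Fin 2) :
    sanovMod k w i j = ((sanov w i j : ℤ) : ZMod (2 ^ k)) := rfl

open Matrix MatrixGroups in
theorem isPGroup_range_sanovMod (k : ℕ) : IsPGroup 2 (sanovMod k).range := by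
  rintro ⟨_, w, rfl⟩
  refine ⟨k, Subtype.ext ?_⟩
  change sanovMod k w ^ 2 ^ k = 1
  rw [← map_pow]
  obtain ⟨N, hN⟩ := exists_sanov_eq w
  obtain ⟨N', hN'⟩ := Matrix.exists_pow_two_pow_eq _ N hN k
  ext i j
  rw [sanovMod_apply, map_pow]
  change (((sanov w : Matrix (Fin 2) (Fin 2) ℤ) ^ 2 ^ k) i j : ZMod (2 ^ k)) = _
  rw [hN']
  have h0 : ((2 : ZMod (2 ^ k)) ^ k) = 0 := by
    exact_mod_cast ZMod.natCast_self (2 ^ k)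
  rw [Matrix.add_apply, Matrix.smul_apply, smul_eq_mul]
  push_cast
  rw [pow_succ, h0]
  simp [Matrix.one_apply]

open Matrix MatrixGroups in
theorem exists_sanovMod_ne_one {w : FreeGroup Bool} (hw : w ≠ 1) : ∃ k, sanovMod k w ≠ 1 := by
  by_contra! h
  refine hw (sanov_injective ?_)
  rw [map_one]
  ext i j
  -- An integer divisible by 2ᵏ and smaller than 2ᵏ in absolute value is zero.
  obtain ⟨k, hk⟩ : ∃ k : ℕ, (sanov w i j - (1 : Matrix (Fin 2) (Fin 2) ℤ) i j).natAbs < 2 ^ k :=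
    ⟨_, Nat.lt_two_pow_self⟩
  have h1 := congrArg (fun M : SL(2, ZMod (2 ^ k)) => M i j) (h k)
  have h2 := (ZMod.intCast_zmod_eq_zero_iff_dvd
      (sanov w i j - (1 : Matrix (Fin 2) (Fin 2) ℤ) i j) (2 ^ k)).1 (by
    push_cast
    rw [sub_eq_zero]
    simpa [Matrix.one_apply, sanovMod_apply] using h1)
  have h3 := Int.eq_zero_of_dvd_of_natAbs_lt_natAbs h2 (by simpa [Int.natAbs_pow] using hk)
  simpa [sub_eq_zero] using h3

/-- The free group of rank two is residually a finite `2`-group. -/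
theorem FreeGroup.exists_isPGroup_two_map_ne_one {w : FreeGroup Bool} (hw : w ≠ 1) :
    ∃ (Q : Type) (_ : Group Q) (_ : Finite Q) (f : FreeGroup Bool →* Q),
      IsPGroup 2 Q ∧ f w ≠ 1 := by
  obtain ⟨k, hk⟩ := exists_sanovMod_ne_one hw
  have : NeZero (2 ^ k) := ⟨by positivity⟩
  refine ⟨(sanovMod k).range, inferInstance, ?_, (sanovMod k).rangeRestrict,
    isPGroup_range_sanovMod k, fun h => hk ?_⟩
  · have : Finite (Matrix.SpecialLinearGroup (Fin 2) (ZMod (2 ^ k))) :=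
      Subtype.finite
    infer_instance
  · simpa using congrArg Subtype.val h

/-! ### A finite 2-group carrying the shear -/

section Wreath

variable (Q : Type) [Group Q]

/-- The permutation `(u, v) ↦ (u, v u²)` of pairs. -/
def pairShear : Equiv.Perm (Q × Q) where
  toFun p := (p.1, p.2 * p.1 ^ 2)
  invFun p := (p.1, p.2 * (p.1 ^ 2)⁻¹)
  left_inv p := by simp
  right_inv p := by simp

/-- Precomposition with `pairShear`. -/
def pairShearAut : MulAut (Q × Q → Q) where
  toFun n p := n (pairShear Q p)
  invFun n p := n ((pairShear Q).symm p)
  left_inv n := by ext p; simp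
  right_inv n := by ext p; simp
  map_mul' _ _ := rfl

theorem pairShearAut_pow_apply (k : ℕ) (n : Q × Q → Q) (p : Q × Q) :
    (pairShearAut Q ^ k) n p = n (p.1, p.2 * p.1 ^ (2 * k)) := by
  induction k generalizing n p with
  | zero => simp
  | succ k ih =>
    rw [pow_succ, MulAut.mul_apply, ih]
    change n (_, _) = _
    simp only [mul_assoc, ← pow_add]
    rfl

/-- The semidirect product of `Q × Q → Q` with the cyclic group generated by `pairShearAut`. -/
abbrev ShearProduct : Type :=
  (Q × Q → Q) ⋊[(Subgroup.zpowers (pairShearAut Q)).subtype] (Subgroup.zpowers (pairShearAut Q))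

variable {Q}

theorem isPGroup_shearProduct [Finite Q] (hQ : IsPGroup 2 Q) : IsPGroup 2 (ShearProduct Q) := by
  obtain ⟨m, hm⟩ := IsPGroup.iff_card.1 hQ
  have hord : orderOf (pairShearAut Q) ∣ 2 ^ m := by
    refine orderOf_dvd_of_pow_eq_one ?_
    ext n p
    -- The |Q|-th power of the shear multiplies v by u^(2|Q|) = 1.
    rw [pairShearAut_pow_apply, mul_comm 2, pow_mul, ← hm, pow_card_eq_one']
    simp
  obtain ⟨j, -, hj⟩ := (Nat.dvd_prime_pow Nat.prime_two).1 hord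
  refine IsPGroup.of_card (n := m * Nat.card (Q × Q) + j) ?_
  rw [SemidirectProduct.card, Nat.card_zpowers, hj, Nat.card_fun, hm, ← pow_mul, ← pow_add]

end Wreath

/-! ### Residual nilpotence from the presentation -/

/-- A group generated by `a, x, t` and presented by the relations `a x = x a`, `t x = x t a²` among
groups in `Type` is residually nilpotent. -/
theorem residuallyNilpotent_of_presentation {G : Type} [Group G] {a x t : G}
    (hgen : Subgroup.closure {a, x, t} = ⊤) (hax : a * x = x * a) (htx : t * x = x * (t * a ^ 2))
    (huniv : ∀ (H : Type) [Group H] (α ξ τ : H), α * ξ = ξ * α → τ * ξ = ξ * (τ * α ^ 2) →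
      ∃ f : G →* H, f a = α ∧ f x = ξ ∧ f t = τ) :
    ResiduallyNilpotent G := by
  let ι : FreeGroup Bool →* G := FreeGroup.lift fun i => bif i then a else t
  have hιa : ι (FreeGroup.of true) = a := by simp [ι]
  have hιt : ι (FreeGroup.of false) = t := by simp [ι]
  have haN : a ∈ ι.range := ⟨_, hιa⟩
  have htN : t ∈ ι.range := ⟨_, hιt⟩
  have hconj (y : G) (ha : y * a * y⁻¹ ∈ ι.range) (ht : y * t * y⁻¹ ∈ ι.range)
      (w : FreeGroup Bool) : y * ι w * y⁻¹ ∈ ι.range := by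
    have h : (((MulAut.conj y).toMonoidHom.comp ι).range) ≤ ι.range := by
      rw [MonoidHom.range_eq_map, ← FreeGroup.closure_range_of, MonoidHom.map_closure,
        Subgroup.closure_le]
      rintro _ ⟨_, ⟨_ | _, rfl⟩, rfl⟩
      · simpa [hιt] using ht
      · simpa [hιa] using ha
    exact h ⟨w, by simp⟩
  have hnormal : ι.range.Normal := by
    rw [← Subgroup.normalizer_eq_top_iff, eq_top_iff, ← hgen, Subgroup.closure_le]
    have hself := Subgroup.le_normalizer (H := ι.range)
    rintro y (rfl | rfl | rfl)
    · exact hself haN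
    · have hxa : y * a * y⁻¹ = a := by rw [← hax, mul_inv_cancel_right]
      have hxt : y * t * y⁻¹ = t * (a ^ 2)⁻¹ := by
        have h2 : y * a ^ 2 * y⁻¹ = a ^ 2 := by rw [← conj_pow, hxa]
        rw [eq_mul_inv_iff_mul_eq]
        nth_rw 1 [← h2]
        calc _ = y * (t * a ^ 2) * y⁻¹ := by group
          _ = t := by rw [← htx, mul_inv_cancel_right]
      have hxa' : y⁻¹ * a * y = a := by rw [mul_assoc, hax, inv_mul_cancel_left]
      have hxt' : y⁻¹ * t * y = t * a ^ 2 := by rw [mul_assoc, htx, inv_mul_cancel_left]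
      rw [SetLike.mem_coe, Subgroup.mem_normalizer_iff]
      intro g
      constructor
      · rintro ⟨w, rfl⟩
        refine hconj y (by rwa [hxa]) ?_ w
        rw [hxt]
        exact mul_mem htN (inv_mem (pow_mem haN 2))
      · rintro ⟨w, hw⟩
        have := hconj y⁻¹ (by rw [inv_inv, hxa']; exact haN)
          (by rw [inv_inv, hxt']; exact mul_mem htN (pow_mem haN 2)) w
        rw [hw] at this
        simpa [mul_assoc] using this
    · exact hself htN
  have hdecomp (g : G) : ∃ w m, g = ι w * x ^ (m : ℤ) := by
    have htop : ι.range ⊔ Subgroup.zpowers x = ⊤ := by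
      rw [eq_top_iff, ← hgen, Subgroup.closure_le]
      rintro y (rfl | rfl | rfl)
      · exact Subgroup.mem_sup_left haN
      · exact Subgroup.mem_sup_right (Subgroup.mem_zpowers y)
      · exact Subgroup.mem_sup_left htN
    have hg : g ∈ ι.range ⊔ Subgroup.zpowers x := htop ▸ Subgroup.mem_top g
    obtain ⟨_, ⟨w, rfl⟩, _, ⟨m, rfl⟩, rfl⟩ := Subgroup.mem_sup_of_normal_left.1 hg
    exact ⟨w, m, rfl⟩
  rw [ResiduallyNilpotent, eq_bot_iff]
  intro g hg
  rw [Subgroup.mem_iInf] at hg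
  have hker {H : Type} [Group H] [Group.IsNilpotent H] (f : G →* H) : f g = 1 := by
    obtain ⟨n, hn⟩ := Subgroup.nilpotent_iff_lowerCentralSeries.1
      (inferInstance : Group.IsNilpotent H)
    have h := Subgroup.mem_map_of_mem f (hg n)
    rw [Subgroup.map_lowerCentralSeries] at h
    have h' : f g ∈ (⊤ : Subgroup H).lowerCentralSeries n :=
      Subgroup.lowerCentralSeries_mono n (le_top : (⊤ : Subgroup G).map f ≤ ⊤) h
    rwa [hn, Subgroup.mem_bot] at h'
  obtain ⟨w, m, rfl⟩ := hdecomp g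
  have hm : m = 0 := by
    obtain ⟨f, ha, hx, ht⟩ := huniv (Multiplicative ℤ) 1 (Multiplicative.ofAdd 1) 1 (by simp)
      (by simp)
    have hι : f.comp ι = 1 := by
      ext i
      rcases i with _ | _ <;> simp [hιa, hιt, ha, ht]
    have h := hker f
    rw [map_mul, ← MonoidHom.comp_apply, hι, map_zpow, hx] at h
    simpa [← ofAdd_zsmul] using h
  subst hm
  rw [zpow_zero, mul_one] at hker ⊢
  by_cases hw : w = 1
  · simp [hw]
  obtain ⟨Q, _, _, ρ, hQ, hρ⟩ := FreeGroup.exists_isPGroup_two_map_ne_one hw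
  exfalso
  -- The pair that encodes ρ; evaluating at it recovers ρ.
  let u : Q × Q := (ρ (FreeGroup.of true), ρ (FreeGroup.of false))
  let θ : Subgroup.zpowers (pairShearAut Q) := ⟨pairShearAut Q, Subgroup.mem_zpowers _⟩
  have hθ1 : (pairShearAut Q) (fun p => p.1) = fun p => p.1 := rfl
  have hθ2 : (pairShearAut Q) (fun p => p.2) = (fun p => p.2) * (fun p => p.1) ^ 2 := rfl
  have hinr (n : Q × Q → Q) :
      (SemidirectProduct.inl n * (SemidirectProduct.inr θ)⁻¹ : ShearProduct Q) =
        (SemidirectProduct.inr θ)⁻¹ * SemidirectProduct.inl (pairShearAut Q n) := by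
    have h := SemidirectProduct.inl_aut (φ := (Subgroup.zpowers (pairShearAut Q)).subtype) θ n
    change SemidirectProduct.inl (pairShearAut Q n) = _ at h
    rw [h, map_inv]
    group
  -- The inverse appears because the shear is conjugation by `inr θ`, while t ↦ ta² is conjugation
  -- by x⁻¹.
  obtain ⟨f, ha, hx, ht⟩ := huniv (ShearProduct Q) (SemidirectProduct.inl fun p => p.1)
    (SemidirectProduct.inr θ)⁻¹ (SemidirectProduct.inl fun p => p.2)
    (by rw [hinr, hθ1]) (by rw [hinr, hθ2, map_mul, map_pow])
  have : Finite (ShearProduct Q) := Finite.of_equiv _ SemidirectProduct.equivProd.symm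
  have : Group.IsNilpotent (ShearProduct Q) := (isPGroup_shearProduct hQ).isNilpotent
  let W : FreeGroup Bool →* (Q × Q → Q) :=
    FreeGroup.lift fun i => bif i then fun p => p.1 else fun p => p.2
  have hfW : f.comp ι = SemidirectProduct.inl.comp W := by
    ext i : 1
    rcases i with _ | _ <;> simp [hιa, hιt, ha, ht, W]
  have hWρ : (Pi.evalMonoidHom (fun _ : Q × Q => Q) u).comp W = ρ := by
    ext i
    rcases i with _ | _ <;> simp [W, u]
  have h := hker f
  rw [← MonoidHom.comp_apply, hfW, MonoidHom.comp_apply, ← map_one SemidirectProduct.inl] at h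
  refine hρ ?_
  rw [← hWρ, MonoidHom.comp_apply, SemidirectProduct.inl_injective h, map_one]

theorem groupComm_eq_one_iff {H : Type*} [Group H] {g h : H} :
    groupComm g h = 1 ↔ Commute g h := by
  rw [groupComm, mul_assoc, ← mul_inv_rev, inv_mul_eq_one, eq_comm]
  rfl

/-- A group generated by `a, b, t` and presented by the relations `[a, b] = 1` and
`a b t = t b a⁻¹` among groups in `Type` is residually nilpotent. -/
theorem residuallyNilpotent_of_groupComm_relator {G : Type} [Group G] {a b t : G}
    (hgen : Subgroup.closure {a, b, t} = ⊤) (hab : groupComm a b = 1)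
    (hrel : relator (a * b * t) (t * b * a⁻¹) = 1)
    (huniv : ∀ (H : Type) [Group H] (α β τ : H), groupComm α β = 1 →
      relator (α * β * τ) (τ * β * α⁻¹) = 1 → ∃ f : G →* H, f a = α ∧ f b = β ∧ f t = τ) :
    ResiduallyNilpotent G := by
  have hab' : Commute a b := (groupComm_eq_one_iff).1 hab
  have hrel' : a * b * t = t * b * a⁻¹ := mul_inv_eq_one.1 hrel
  refine residuallyNilpotent_of_presentation (a := a) (x := a * b) (t := t) ?_ ?_ ?_ ?_
  · rw [eq_top_iff, ← hgen, Subgroup.closure_le]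
    have ha : a ∈ Subgroup.closure {a, a * b, t} := Subgroup.subset_closure (by simp)
    have hb : a * b ∈ Subgroup.closure {a, a * b, t} := Subgroup.subset_closure (by simp)
    have ht : t ∈ Subgroup.closure {a, a * b, t} := Subgroup.subset_closure (by simp)
    rintro y (rfl | rfl | rfl)
    exacts [ha, by simpa using mul_mem (inv_mem ha) hb, ht]
  · exact (Commute.refl a).mul_right hab'
  -- xta² = tba⁻¹a² = tba = tx.
  · rw [← mul_assoc (a * b), hrel', hab'.eq, sq, ← mul_assoc, ← mul_assoc, inv_mul_cancel_right]
  · intro H _ α ξ τ h1 h2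
    have h3 : Commute α ξ := h1
    obtain ⟨f, ha, hb, ht⟩ := huniv H α (α⁻¹ * ξ) τ
      ((groupComm_eq_one_iff).2 ((Commute.refl α).inv_right.mul_right h3))
      (by
        rw [relator, mul_inv_cancel_left, mul_inv_eq_one, h3.inv_left.eq, ← mul_assoc, h2]
        group)
    exact ⟨f, ha, by rw [map_mul, ha, hb, mul_inv_cancel_left], ht⟩

theorem mainTheorem5 : ResiduallyNilpotent UTilde3 ∧ ResiduallyNilpotent LTilde3 := by
  constructor
  · refine residuallyNilpotent_of_groupComm_relator (a := PresentedGroup.of .μ13)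
      (b := PresentedGroup.of .μ23) (t := PresentedGroup.of .μ12) ?_
      (PresentedGroup.one_of_mem (rels := upperRels) (Set.mem_insert _ _))
      (PresentedGroup.one_of_mem (rels := upperRels) (Set.mem_insert_of_mem _ rfl)) ?_
    · rw [eq_top_iff, ← PresentedGroup.closure_range_of]
      refine Subgroup.closure_mono ?_
      rintro _ ⟨_ | _ | _, rfl⟩ <;> simp
    · intro H _ α β τ h1 h2
      have hf : ∀ r ∈ upperRels, FreeGroup.lift
          (fun i : UpperGen => match i with | .μ12 => τ | .μ13 => α | .μ23 => β) r = 1 := by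
        rintro r (rfl | rfl)
        · simpa [groupComm] using h1
        · simpa [relator] using h2
      refine ⟨PresentedGroup.toGroup hf, ?_, ?_, ?_⟩ <;> simp
  · refine residuallyNilpotent_of_groupComm_relator (a := PresentedGroup.of .μ31)
      (b := PresentedGroup.of .μ21) (t := PresentedGroup.of .μ32) ?_ ?_
      (PresentedGroup.one_of_mem (rels := lowerRels) (Set.mem_insert_of_mem _ rfl)) ?_
    · rw [eq_top_iff, ← PresentedGroup.closure_range_of]
      refine Subgroup.closure_mono ?_
      rintro _ ⟨_ | _ | _, rfl⟩ <;> simp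
    · have h : groupComm (PresentedGroup.of .μ21) (PresentedGroup.of .μ31 : LTilde3) = 1 :=
        PresentedGroup.one_of_mem (rels := lowerRels) (Set.mem_insert _ _)
      rw [groupComm_eq_one_iff] at h ⊢
      exact h.symm
    · intro H _ α β τ h1 h2
      replace h1 := groupComm_eq_one_iff.2 (groupComm_eq_one_iff.1 h1).symm
      have hf : ∀ r ∈ lowerRels, FreeGroup.lift
          (fun i : LowerGen => match i with | .μ32 => τ | .μ31 => α | .μ21 => β) r = 1 := by
        rintro r (rfl | rfl)
        · simpa [groupComm] using h1
        · simpa [relator] using h2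
      refine ⟨PresentedGroup.toGroup hf, ?_, ?_, ?_⟩ <;> simp
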